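/- For metric spaces $X,Y$ and a map $f:X\to Y$ let $\operatorname{dis}(f)=\sup_{x,x'\in X}|d_X(x,x')-d_Y(f(x),f(x'))|$. Let $d_{\mathrm{GH}}(X,Y)\in[0,\infty]$ be the Gromov–Hausdorff distance, i.e. the infimum of the Hausdorff distances $d_{\mathrm H}^Z(\Phi(X),\Psi(Y))$ over all metric spaces $Z$ and all isometric embeddings $\Phi:X\to Z$, $\Psi:Y\to Z$, and let $$\widehat d_{\mathrm{GH}}(X,Y)=\tfrac12\inf_{f:X\to Y,\ g:Y\to X}\max\{\operatorname{dis}(f),\operatorname{dis}(g)\}$$ be the modified Gromov–Hausdorff distance, where $f,g$ range over all (not necessarily continuous) maps. A regular simplex is a metric space, of any finite or infinite cardinality, whose nonzero distances are all equal. Theorem. Let $\Delta$ be a regular simplex and $X$ a compact metric space. Then: 1. $d_{\mathrm{GH}}(X,\Delta)\le 2\,\widehat d_{\mathrm{GH}}(X,\Delta)$, and this bound is tight: for every $C<2$ there are a finite metric space $X$ and a finite regular simplex $\Delta$ with $d_{\mathrm{GH}}(X,\Delta)> C\,\widehat d_{\mathrm{GH}}(X,\Delta)$. Explicitly, for every integer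 $n\ge 1$, if $X=\{x_1,\dots,x_{n+1}\}$ with $d_X(x_k,x_j)=|k-j|$ and $\Delta=\{y_1,y_2\}$ with $d_\Delta(y_1,y_2)=2n$, then $$\frac{d_{\mathrm{GH}}(X,\Delta)}{\widehat d_{\mathrm{GH}}(X,\Delta)}=2-\frac1n .$$ 2. $d_{\mathrm{GH}}(X,\Delta)=\widehat d_{\mathrm{GH}}(X,\Delta)$ whenever $|X|<|\Delta|$, or $|X|=|\Delta|<\infty$, or $\operatorname{diam}\Delta\le\tfrac12\operatorname{diam}X$. -/

import Mathlib

open scoped ENNReal Cardinal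

universe u v

/-- The distortion `sup_{x,x'} |d_X(x,x') - d_Y(f x, f x')|` of an arbitrary map, as an element
of `[0,∞]`. -/
noncomputable def distortion {X : Type u} {Y : Type v} [MetricSpace X] [MetricSpace Y]
    (f : X → Y) : ℝ≥0∞ :=
  ⨆ (x : X) (x' : X), ENNReal.ofReal |dist x x' - dist (f x) (f x')|

/-- The Gromov–Hausdorff distance, as an element of `[0,∞]`: the infimum of the Hausdorff
distances between isometric copies of `X` and `Y` in a common metric space `Z`. Replacing `Z` by
the union of the two copies shows that `Z` in the universe `max u v` is no restriction.
The spaces need not be compact. -/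
noncomputable def eGHDist (X : Type u) (Y : Type v) [MetricSpace X] [MetricSpace Y] : ℝ≥0∞ :=
  ⨅ (Z : Type (max u v)) (_ : MetricSpace Z) (Φ : X → Z) (Ψ : Y → Z)
    (_ : Isometry Φ) (_ : Isometry Ψ), Metric.hausdorffEDist (Set.range Φ) (Set.range Ψ)

/-- The modified Gromov–Hausdorff distance, as an element of `[0,∞]`:
`1/2 inf_{f, g} max {dis f, dis g}` over all maps `f : X → Y` and `g : Y → X`. -/
noncomputable def eMGHDist (X : Type u) (Y : Type v) [MetricSpace X] [MetricSpace Y] : ℝ≥0∞ :=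
  (⨅ (f : X → Y) (g : Y → X), max (distortion f) (distortion g)) / 2

/-- A regular simplex is a metric space (of any cardinality) all of whose nonzero distances are
equal. -/
def IsRegularSimplex (S : Type u) [MetricSpace S] : Prop :=
  ∀ x y x' y' : S, x ≠ y → x' ≠ y' → dist x y = dist x' y'

/-! ### Correspondences and distortion bounds for the two distances. -/

section Distances

variable {X : Type u} {Y : Type v} [MetricSpace X] [MetricSpace Y]

/-! A bound on `eGHDist` amounts to a correspondence of small distortion; `eMGHDist` uses unrelated
`f` and `g`, which can be chosen inside a correspondence, so it is never larger. Conversely, let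
`f`, `g` have distortion at most `D` and let the simplex have diameter `δ`. If `δ ≤ D`, the points
missed by `f` can be matched arbitrarily (`IsRegularSimplex.eGHDist_le_of_diam_le`). If `D < δ`,
then `g` is injective, which each equality hypothesis either contradicts or upgrades to bijectivity.
For the factor `2` the same dichotomy is run at `2 * D`, which bounds the distortion of `f ∘ g`: if
`2 * D < δ`, compactness makes the simplex finite, so the injective `f ∘ g` is onto, and so is `f`.
Sharpness: a correspondence of small distortion must be constant along a path. -/

theorem distortion_le_ofReal_iff {f : X → Y} {D : ℝ} (hD : 0 ≤ D) :
    distortion f ≤ ENNReal.ofReal D ↔ ∀ x x', |dist x x' - dist (f x) (f x')| ≤ D := by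
  simp only [distortion, iSup_le_iff, ENNReal.ofReal_le_ofReal_iff hD]

theorem eGHDist_le_hausdorffEDist {Z : Type (max u v)} [m : MetricSpace Z] {Φ : X → Z} {Ψ : Y → Z}
    (hΦ : Isometry Φ) (hΨ : Isometry Ψ) :
    eGHDist X Y ≤ Metric.hausdorffEDist (Set.range Φ) (Set.range Ψ) :=
  (iInf₂_le Z m).trans <| (iInf₂_le Φ Ψ).trans <| iInf₂_le hΦ hΨ

/-- Covers the empty case, excluded from the gluing construction; any ambient space would serve. -/
theorem eGHDist_le_of_isEmpty [IsEmpty X] [IsEmpty Y] (c : ℝ≥0∞) : eGHDist X Y ≤ c := by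
  have h := eGHDist_le_hausdorffEDist (X := X) (Y := Y) (Z := ULift.{max u v} ℕ)
    (Φ := isEmptyElim) (Ψ := isEmptyElim) (fun x => isEmptyElim x) (fun y => isEmptyElim y)
  rw [Set.range_eq_empty, Set.range_eq_empty, Metric.hausdorffEDist_self] at h
  exact h.trans zero_le

/-- A correspondence, parametrised by a type `Z`, of distortion at most `2 r` bounds the
Gromov–Hausdorff distance by `r`. -/
theorem eGHDist_le_of_correspondence {Z : Type*} [Nonempty Z] {Φ : Z → X} {Ψ : Z → Y}
    (hΦ : Function.Surjective Φ) (hΨ : Function.Surjective Ψ) {r : ℝ} (hr : 0 ≤ r)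
    (h : ∀ p q, |dist (Φ p) (Φ q) - dist (Ψ p) (Ψ q)| ≤ 2 * r) :
    eGHDist X Y ≤ ENNReal.ofReal r := by
  refine ENNReal.le_of_forall_pos_le_add fun ε hε _ => ?_
  have hε' : (0 : ℝ) < ε := hε
  have hrε : 0 < r + ε := by linarith
  have h' : ∀ p q, |dist (Φ p) (Φ q) - dist (Ψ p) (Ψ q)| ≤ 2 * (r + ε) :=
    fun p q => (h p q).trans (by linarith)
  -- The gap between glued points must be positive to give a metric, hence `r + ε` even when `r =
  -- 0`.
  let m : MetricSpace (X ⊕ Y) := Metric.glueMetricApprox Φ Ψ (r + ε) hrε h'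
  have hd : ∀ p, edist (Sum.inl (Φ p) : X ⊕ Y) (Sum.inr (Ψ p)) ≤ ENNReal.ofReal (r + ε) := by
    intro p
    rw [edist_dist]
    exact ENNReal.ofReal_le_ofReal (Metric.glueDist_glued_points Φ Ψ (r + ε) p).le
  have hinl : Isometry (Sum.inl : X → X ⊕ Y) := Isometry.of_dist_eq fun _ _ => rfl
  have hinr : Isometry (Sum.inr : Y → X ⊕ Y) := Isometry.of_dist_eq fun _ _ => rfl
  refine (eGHDist_le_hausdorffEDist hinl hinr).trans ?_
  rw [← ENNReal.ofReal_coe_nnreal, ← ENNReal.ofReal_add hr hε'.le]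
  refine Metric.hausdorffEDist_le_of_mem_edist ?_ ?_
  · rintro _ ⟨x, rfl⟩
    obtain ⟨p, rfl⟩ := hΦ x
    exact ⟨_, ⟨Ψ p, rfl⟩, hd p⟩
  · rintro _ ⟨y, rfl⟩
    obtain ⟨p, rfl⟩ := hΨ y
    exact ⟨_, ⟨Φ p, rfl⟩, by rw [edist_comm]; exact hd p⟩

theorem eGHDist_le_of_surjective [Nonempty X] {f : X → Y} (hf : Function.Surjective f) {D : ℝ}
    (hD : 0 ≤ D) (h : ∀ x x', |dist x x' - dist (f x) (f x')| ≤ D) :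
    eGHDist X Y ≤ ENNReal.ofReal (D / 2) :=
  eGHDist_le_of_correspondence Function.surjective_id hf (by positivity)
    fun x x' => (h x x').trans (by linarith)

/-- To bound the Gromov–Hausdorff distance from below, it suffices to bound the distortion of every
correspondence from below. -/
theorem le_eGHDist {c : ℝ≥0∞}
    (h : ∀ (r : ℝ) (R : X → Y → Prop), 0 ≤ r → (∀ x, ∃ y, R x y) → (∀ y, ∃ x, R x y) →
      (∀ x y x' y', R x y → R x' y' → |dist x x' - dist y y'| ≤ 2 * r) → c ≤ ENNReal.ofReal r) :
    c ≤ eGHDist X Y := by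
  refine le_iInf₂ fun Z _ => le_iInf₂ fun Φ Ψ => le_iInf₂ fun hΦ hΨ => ?_
  refine ENNReal.le_of_forall_pos_le_add fun ε hε hfin => ?_
  set H := Metric.hausdorffEDist (Set.range Φ) (Set.range Ψ) with hH
  have hlt : H < H + ε := ENNReal.lt_add_right hfin.ne (by simpa using hε.ne')
  have htop : H + ε ≠ ⊤ := by simp [hfin.ne]
  rw [← ENNReal.ofReal_toReal htop]
  -- Points closer than `H + ε` are related; the slack makes the relation total on both sides, and
  -- the triangle inequality bounds its distortion.
  refine h _ (fun x y => edist (Φ x) (Ψ y) < H + ε) ENNReal.toReal_nonneg ?_ ?_ ?_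
  · intro x
    obtain ⟨_, ⟨y, rfl⟩, hy⟩ :=
      Metric.exists_edist_lt_of_hausdorffEDist_lt (Set.mem_range_self x) hlt
    exact ⟨y, hy⟩
  · intro y
    rw [hH, Metric.hausdorffEDist_comm] at hlt
    obtain ⟨_, ⟨x, rfl⟩, hx⟩ :=
      Metric.exists_edist_lt_of_hausdorffEDist_lt (Set.mem_range_self y) hlt
    refine ⟨x, ?_⟩
    rw [edist_comm, hH, Metric.hausdorffEDist_comm]
    exact hx
  · intro x y x' y' hxy hxy'
    have key : ∀ x y, edist (Φ x) (Ψ y) < H + ε → dist (Φ x) (Ψ y) ≤ (H + ε).toReal := by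
      intro x y hxy
      rw [dist_edist]
      exact ENNReal.toReal_mono htop hxy.le
    have h1 := key x y hxy
    have h2 := key x' y' hxy'
    rw [← hΦ.dist_eq, ← hΨ.dist_eq, abs_le]
    have t1 := dist_triangle4 (Φ x) (Ψ y) (Ψ y') (Φ x')
    have t2 := dist_triangle4 (Ψ y) (Φ x) (Φ x') (Ψ y')
    rw [dist_comm (Ψ y') (Φ x')] at t1
    rw [dist_comm (Ψ y) (Φ x)] at t2
    constructor <;> linarith

theorem eMGHDist_le {f : X → Y} {g : Y → X} {D : ℝ} (hD : 0 ≤ D)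
    (hf : ∀ x x', |dist x x' - dist (f x) (f x')| ≤ D)
    (hg : ∀ y y', |dist y y' - dist (g y) (g y')| ≤ D) :
    eMGHDist X Y ≤ ENNReal.ofReal (D / 2) := by
  rw [ENNReal.ofReal_div_of_pos two_pos, ENNReal.ofReal_ofNat]
  exact ENNReal.div_le_div_right (iInf₂_le_of_le f g <|
    max_le ((distortion_le_ofReal_iff hD).2 hf) ((distortion_le_ofReal_iff hD).2 hg)) 2

theorem le_eMGHDist {c : ℝ≥0∞}
    (h : ∀ (D : ℝ) (f : X → Y) (g : Y → X), 0 ≤ D →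
      (∀ x x', |dist x x' - dist (f x) (f x')| ≤ D) →
      (∀ y y', |dist y y' - dist (g y) (g y')| ≤ D) → c ≤ ENNReal.ofReal (D / 2)) :
    c ≤ eMGHDist X Y := by
  rw [eMGHDist, ENNReal.le_div_iff_mul_le (by simp) (by simp)]
  refine le_iInf₂ fun f g => ?_
  by_cases htop : max (distortion f) (distortion g) = ⊤
  · simp [htop]
  · set M := max (distortion f) (distortion g) with hM
    rw [← ENNReal.le_div_iff_mul_le (by simp) (by simp)]
    have hD : 0 ≤ M.toReal := ENNReal.toReal_nonneg
    have := h M.toReal f g hD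
      ((distortion_le_ofReal_iff hD).1 (by rw [ENNReal.ofReal_toReal htop]; exact le_max_left _ _))
      ((distortion_le_ofReal_iff hD).1 (by rw [ENNReal.ofReal_toReal htop]; exact le_max_right _ _))
    rwa [ENNReal.ofReal_div_of_pos two_pos, ENNReal.ofReal_ofNat,
      ENNReal.ofReal_toReal htop] at this

theorem eMGHDist_le_eGHDist : eMGHDist X Y ≤ eGHDist X Y := by
  refine le_eGHDist fun r R hr hX hY h => ?_
  choose f hf using hX
  choose g hg using hY
  have := eMGHDist_le (f := f) (g := g) (D := 2 * r) (by linarith)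
    (fun x x' => h _ _ _ _ (hf x) (hf x'))
    (fun y y' => by rw [abs_sub_comm]; exact h _ _ _ _ (hg y) (hg y'))
  rwa [mul_div_cancel_left₀ r two_ne_zero] at this

end Distances

/-! ### Bounds and equality for regular simplices. -/

section RegularSimplex

variable {X : Type u} {S : Type v} [MetricSpace X] [MetricSpace S]

theorem IsRegularSimplex.dist_eq_diam (hS : IsRegularSimplex S) {s t : S} (hst : s ≠ t) :
    dist s t = Metric.diam (Set.univ : Set S) := by
  -- `Metric.diam` is `0` on unbounded sets, so boundedness has to be shown too.
  have hle : ∀ x ∈ (Set.univ : Set S), ∀ y ∈ (Set.univ : Set S), dist x y ≤ dist s t := by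
    intro x _ y _
    rcases eq_or_ne x y with rfl | hxy
    · simp
    · exact (hS x y s t hxy hst).le
  exact le_antisymm
    (Metric.dist_le_diam_of_mem (Metric.isBounded_iff.2 ⟨_, fun x hx y hy => hle x hx y hy⟩)
      trivial trivial)
    (Metric.diam_le_of_forall_dist_le dist_nonneg hle)

theorem IsRegularSimplex.dist_le_diam (hS : IsRegularSimplex S) (s t : S) :
    dist s t ≤ Metric.diam (Set.univ : Set S) := by
  rcases eq_or_ne s t with rfl | hst
  · simpa using Metric.diam_nonneg
  · exact (hS.dist_eq_diam hst).le

/-- A map into a regular simplex whose distortion is at least the diameter of the simplex extends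
to a correspondence without increasing the distortion: the points outside of the range may be
matched arbitrarily. -/
theorem IsRegularSimplex.eGHDist_le_of_diam_le [Nonempty X] (hS : IsRegularSimplex S) {f : X → S}
    {D : ℝ} (h : ∀ x x', |dist x x' - dist (f x) (f x')| ≤ D)
    (hD : Metric.diam (Set.univ : Set S) ≤ D) : eGHDist X S ≤ ENNReal.ofReal (D / 2) := by
  have hD0 : 0 ≤ D := Metric.diam_nonneg.trans hD
  obtain ⟨x₀⟩ := ‹Nonempty X›
  -- Always `dist x x' ≤ D + diam S`, from `f`; the other inequality is `diam S ≤ D`.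
  have hdiff : ∀ (x x' : X) (s s' : S), s ≠ s' → |dist x x' - dist s s'| ≤ D := by
    intro x x' s s' hs
    have h1 := (abs_le.1 (h x x')).2
    have h2 := hS.dist_le_diam (f x) (f x')
    have h3 := dist_nonneg (x := x) (y := x')
    rw [hS.dist_eq_diam hs, abs_le]
    constructor <;> linarith
  let Φ : X ⊕ ↥(Set.range f)ᶜ → X := Sum.elim id fun _ => x₀
  let Ψ : X ⊕ ↥(Set.range f)ᶜ → S := Sum.elim f Subtype.val
  have : Nonempty (X ⊕ ↥(Set.range f)ᶜ) := ⟨.inl x₀⟩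
  refine eGHDist_le_of_correspondence (Φ := Φ) (Ψ := Ψ) (fun x => ⟨.inl x, rfl⟩) ?_
    (by positivity) ?_
  · intro s
    by_cases hs : s ∈ Set.range f
    · obtain ⟨x, rfl⟩ := hs
      exact ⟨.inl x, rfl⟩
    · exact ⟨.inr ⟨s, hs⟩, rfl⟩
  · rw [mul_div_cancel₀ D two_ne_zero]
    rintro (x | ⟨s, hs⟩) (x' | ⟨s', hs'⟩)
    · exact h x x'
    · exact hdiff _ _ _ _ fun e => hs' ⟨x, e⟩
    · exact hdiff _ _ _ _ fun e => hs ⟨x', e.symm⟩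
    · rcases eq_or_ne s s' with rfl | hne
      · simpa [Φ, Ψ] using hD0
      · exact hdiff _ _ _ _ hne

/-- A map out of a regular simplex with distortion less than the diameter is injective. -/
theorem IsRegularSimplex.injective_of_lt_diam (hS : IsRegularSimplex S) {g : S → X} {D : ℝ}
    (h : ∀ s s', |dist s s' - dist (g s) (g s')| ≤ D)
    (hD : D < Metric.diam (Set.univ : Set S)) : Function.Injective g := by
  intro s s' hs
  by_contra hne
  have := (abs_le.1 (h s s')).2
  rw [hs, dist_self, hS.dist_eq_diam hne] at this
  linarith

/-- An infinite separated family would contain a sequence with no Cauchy subsequence. -/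
theorem finite_of_dist_ge [CompactSpace X] {T : Type*} {g : T → X} {δ : ℝ} (hδ : 0 < δ)
    (h : ∀ s s', s ≠ s' → δ ≤ dist (g s) (g s')) : Finite T := by
  by_contra hT
  rw [not_finite_iff_infinite] at hT
  let e := Infinite.natEmbedding T
  obtain ⟨a, φ, hφ, hlim⟩ := CompactSpace.tendsto_subseq fun n => g (e n)
  obtain ⟨N, hN⟩ := Metric.cauchySeq_iff.1 hlim.cauchySeq δ hδ
  have hlt := hN N le_rfl (N + 1) N.le_succ
  refine (h _ _ ?_).not_gt hlt
  exact fun heq => (hφ N.lt_succ_self).ne (e.injective heq)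

theorem IsRegularSimplex.eGHDist_le_two_mul [CompactSpace X] (hS : IsRegularSimplex S) :
    eGHDist X S ≤ 2 * eMGHDist X S := by
  rw [mul_comm, ← ENNReal.div_le_iff_le_mul (by simp) (by simp)]
  refine le_eMGHDist fun D f g hD hf hg => ?_
  rw [ENNReal.div_le_iff_le_mul (by simp) (by simp), ← ENNReal.ofReal_ofNat 2,
    ← ENNReal.ofReal_mul (by positivity), div_mul_cancel₀ D two_ne_zero]
  rcases isEmpty_or_nonempty X with hX | hX
  · have := Function.isEmpty g
    exact eGHDist_le_of_isEmpty _
  rcases le_or_gt (Metric.diam (Set.univ : Set S)) (2 * D) with hle | hlt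
  · have := hS.eGHDist_le_of_diam_le (D := 2 * D) (fun x x' => (hf x x').trans (by linarith)) hle
    rwa [mul_div_cancel_left₀ D two_ne_zero] at this
  · have hgsep : ∀ s s', s ≠ s' →
        Metric.diam (Set.univ : Set S) - D ≤ dist (g s) (g s') := by
      intro s s' hs
      have := (abs_le.1 (hg s s')).2
      rw [hS.dist_eq_diam hs] at this
      linarith
    have : Finite S := finite_of_dist_ge (by linarith) hgsep
    have hfg : Function.Injective (f ∘ g) := by
      refine hS.injective_of_lt_diam (D := 2 * D) (fun s s' => ?_) hlt
      have := abs_sub_le (dist s s') (dist (g s) (g s')) (dist (f (g s)) (f (g s')))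
      exact this.trans (by linarith [hg s s', hf (g s) (g s')])
    have hsurj : Function.Surjective f := (Finite.surjective_of_injective hfg).of_comp
    exact (eGHDist_le_of_surjective hsurj hD hf).trans
      (ENNReal.ofReal_le_ofReal (by linarith))

theorem IsRegularSimplex.eGHDist_eq_eMGHDist (hS : IsRegularSimplex S)
    (h : Cardinal.lift.{v} #X < Cardinal.lift.{u} #S ∨
      (Cardinal.lift.{v} #X = Cardinal.lift.{u} #S ∧ #S < ℵ₀) ∨
      Metric.diam (Set.univ : Set S) ≤ 1 / 2 * Metric.diam (Set.univ : Set X)) :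
    eGHDist X S = eMGHDist X S := by
  refine le_antisymm (le_eMGHDist fun D f g hD hf hg => ?_) eMGHDist_le_eGHDist
  rcases isEmpty_or_nonempty X with hX | hX
  · have := Function.isEmpty g
    exact eGHDist_le_of_isEmpty _
  rcases le_or_gt (Metric.diam (Set.univ : Set S)) D with hle | hlt
  · exact hS.eGHDist_le_of_diam_le hf hle
  have hinj := hS.injective_of_lt_diam hg hlt
  rcases h with h | ⟨h, hfin⟩ | h
  · exact absurd (Cardinal.lift_mk_le_lift_mk_of_injective hinj) h.not_ge
  · have : Finite S := Cardinal.lt_aleph0_iff_finite.1 hfin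
    obtain ⟨e⟩ := Cardinal.lift_mk_eq'.1 h
    have hsurj := (Finite.injective_iff_surjective_of_equiv e.symm).1 hinj
    have : Nonempty S := ⟨f hX.some⟩
    exact eGHDist_le_of_correspondence hsurj Function.surjective_id (by positivity)
      fun s s' => by
        rw [abs_sub_comm]
        exact (hg s s').trans (by linarith)
  · have hdiam : Metric.diam (Set.univ : Set X) ≤ D + Metric.diam (Set.univ : Set S) := by
      refine Metric.diam_le_of_forall_dist_le (add_nonneg hD Metric.diam_nonneg)
        fun x _ x' _ => ?_
      linarith [(abs_le.1 (hf x x')).2, hS.dist_le_diam (f x) (f x')]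
    linarith

end RegularSimplex

/-! ### The path against two points; isometries into `ℕ` allow both subtypes and their universe
lifts. -/

section Path

variable {X : Type u} {S : Type v} [MetricSpace X] [MetricSpace S]

theorem isRegularSimplex_of_range_eq_pair {p : S → ℕ} (hp : Isometry p) {a b : ℕ}
    (hr : Set.range p = {a, b}) : IsRegularSimplex S := by
  have hpair : ∀ s, p s = a ∨ p s = b := fun s => by
    have : p s ∈ ({a, b} : Set ℕ) := hr ▸ Set.mem_range_self s
    simpa using this
  have key : ∀ s t : S, s ≠ t → dist s t = dist a b := by
    intro s t hst
    have hne : p s ≠ p t := hp.injective.ne hst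
    rw [← hp.dist_eq]
    rcases hpair s with h | h <;> rcases hpair t with h' | h' <;> rw [h, h'] at hne ⊢
    · exact absurd rfl hne
    · exact dist_comm _ _
    · exact absurd rfl hne
  intro s t s' t' h h'
  rw [key s t h, key s' t' h']

variable {n : ℕ} {e : X → ℕ} {p : S → ℕ}

theorem eGHDist_path (hn : 1 ≤ n) (he : Isometry e) (her : Set.range e = Set.Icc 1 (n + 1))
    (hp : Isometry p) (hpr : Set.range p = {0, 2 * n}) :
    eGHDist X S = ENNReal.ofReal ((2 * n - 1) / 2) := by
  have hn' : (1 : ℝ) ≤ n := by exact_mod_cast hn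
  have hmem : ∀ x, 1 ≤ e x ∧ e x ≤ n + 1 := fun x => by
    have : e x ∈ Set.Icc 1 (n + 1) := her ▸ Set.mem_range_self x
    exact this
  have hex : ∀ k, 1 ≤ k → k ≤ n + 1 → ∃ x, e x = k := fun k h1 h2 => by
    have : k ∈ Set.range e := her ▸ ⟨h1, h2⟩
    exact this
  have hpair : ∀ s, p s = 0 ∨ p s = 2 * n := fun s => by
    have : p s ∈ ({0, 2 * n} : Set ℕ) := hpr ▸ Set.mem_range_self s
    simpa using this
  obtain ⟨s₀, hs₀⟩ : ∃ s, p s = 0 := by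
    have : 0 ∈ Set.range p := by simp [hpr]
    exact this
  obtain ⟨s₁, hs₁⟩ : ∃ s, p s = 2 * n := by
    have : 2 * n ∈ Set.range p := by simp [hpr]
    exact this
  have hdX : ∀ x x' : X, dist x x' = |(e x : ℝ) - e x'| := fun x x' => by
    rw [← he.dist_eq x x', Nat.dist_eq]
  have hdS : ∀ s s' : S, dist s s' = |(p s : ℝ) - p s'| := fun s s' => by
    rw [← hp.dist_eq, Nat.dist_eq]
  refine le_antisymm ?_ (le_eGHDist fun r R hr hRX hRS hR => ?_)
  · obtain ⟨x₁, hx₁⟩ := hex 1 le_rfl (by omega)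
    obtain ⟨x₂, hx₂⟩ := hex 2 (by omega) (by omega)
    have : Nonempty X := ⟨x₁⟩
    -- Splitting off an end of the path: the worst pair is `1`, `2`, at distance `1` against `2 *
    -- n`.
    refine eGHDist_le_of_surjective (f := fun x => if e x = 1 then s₀ else s₁) ?_ (by linarith) ?_
    · intro s
      rcases hpair s with h | h
      · exact ⟨x₁, by simpa [hx₁] using hp.injective (hs₀.trans h.symm)⟩
      · exact ⟨x₂, by simpa [hx₂] using hp.injective (hs₁.trans h.symm)⟩
    · intro x x'
      have h0 : dist s₀ s₁ = 2 * n := by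
        rw [hdS, hs₀, hs₁, abs_sub_comm]
        push_cast
        rw [sub_zero, abs_of_nonneg (by positivity)]
      have b1 : (1 : ℝ) ≤ e x := by exact_mod_cast (hmem x).1
      have b2 : (e x : ℝ) ≤ n + 1 := by exact_mod_cast (hmem x).2
      have b3 : (1 : ℝ) ≤ e x' := by exact_mod_cast (hmem x').1
      have b4 : (e x' : ℝ) ≤ n + 1 := by exact_mod_cast (hmem x').2
      have hle : dist x x' ≤ n := by
        rw [hdX, abs_le]; constructor <;> linarith
      have hsep : e x ≠ e x' → 1 ≤ dist x x' := by
        intro hne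
        rw [hdX]
        have : (1 : ℤ) ≤ |(e x : ℤ) - e x'| := Int.one_le_abs (by omega)
        exact_mod_cast this
      have h3 := dist_nonneg (x := x) (y := x')
      by_cases h : e x = 1 <;> by_cases h' : e x' = 1
      · simp only [h, h', if_true, dist_self, sub_zero]
        rw [abs_le]; constructor <;> linarith
      · simp only [h, h', if_true, if_false, h0]
        have := hsep (by omega)
        rw [abs_le]; constructor <;> linarith
      · simp only [h, h', if_true, if_false, dist_comm s₁ s₀, h0]
        have := hsep (by omega)
        rw [abs_le]; constructor <;> linarith
      · simp only [h, h', if_false, dist_self, sub_zero]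
        rw [abs_le]; constructor <;> linarith
  · refine ENNReal.ofReal_le_ofReal ?_
    by_contra! hlt
    -- Matching distance at most `1` with `2 * n` would cost at least `2 * n - 1 > 2 * r`.
    have hadj : ∀ x s x' s', R x s → R x' s' → dist x x' ≤ 1 → p s = p s' := by
      intro x s x' s' hxs hxs' hd
      by_contra hne
      have h2 : dist s s' = 2 * n := by
        rw [hdS]
        rcases hpair s with h | h <;> rcases hpair s' with h' | h' <;> simp_all
      have := (abs_le.1 (hR x s x' s' hxs hxs')).1
      linarith
    obtain ⟨x₁, hx₁⟩ := hex 1 le_rfl (by omega)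
    obtain ⟨t, ht⟩ := hRX x₁
    have hall : ∀ k, ∀ x s, e x = k + 1 → R x s → p s = p t := by
      intro k
      induction k with
      | zero =>
        intro x s hx hxs
        have : x = x₁ := he.injective (by omega)
        exact hadj x s x₁ t hxs ht (by simp [this])
      | succ k ih =>
        intro x s hx hxs
        obtain ⟨x', hx'⟩ := hex (k + 1) (by omega) (by have := (hmem x).2; omega)
        obtain ⟨s', hs'⟩ := hRX x'
        rw [← ih x' s' hx' hs']
        refine hadj x s x' s' hxs hs' ?_
        rw [hdX, hx, hx']
        simp
    have hconst : ∀ s, p s = p t := by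
      intro s
      obtain ⟨x, hx⟩ := hRS s
      exact hall (e x - 1) x s (by have := (hmem x).1; omega) hx
    have := (hconst s₀).trans (hconst s₁).symm
    omega

theorem eMGHDist_path (he : Isometry e) (her : Set.range e = Set.Icc 1 (n + 1))
    (hp : Isometry p) (hpr : Set.range p = {0, 2 * n}) :
    eMGHDist X S = ENNReal.ofReal (n / 2) := by
  have hn' : (0 : ℝ) ≤ n := n.cast_nonneg
  have hmem : ∀ x, 1 ≤ e x ∧ e x ≤ n + 1 := fun x => by
    have : e x ∈ Set.Icc 1 (n + 1) := her ▸ Set.mem_range_self x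
    exact this
  have hex : ∀ k, 1 ≤ k → k ≤ n + 1 → ∃ x, e x = k := fun k h1 h2 => by
    have : k ∈ Set.range e := her ▸ ⟨h1, h2⟩
    exact this
  have hpair : ∀ s, p s = 0 ∨ p s = 2 * n := fun s => by
    have : p s ∈ ({0, 2 * n} : Set ℕ) := hpr ▸ Set.mem_range_self s
    simpa using this
  obtain ⟨s₀, hs₀⟩ : ∃ s, p s = 0 := by
    have : 0 ∈ Set.range p := by simp [hpr]
    exact this
  obtain ⟨s₁, hs₁⟩ : ∃ s, p s = 2 * n := by
    have : 2 * n ∈ Set.range p := by simp [hpr]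
    exact this
  have hdX : ∀ x x' : X, dist x x' = |(e x : ℝ) - e x'| := fun x x' => by
    rw [← he.dist_eq x x', Nat.dist_eq]
  have hdS : ∀ s s' : S, dist s s' = |(p s : ℝ) - p s'| := fun s s' => by
    rw [← hp.dist_eq, Nat.dist_eq]
  have hle : ∀ x x' : X, dist x x' ≤ n := by
    intro x x'
    have b1 : (1 : ℝ) ≤ e x := by exact_mod_cast (hmem x).1
    have b2 : (e x : ℝ) ≤ n + 1 := by exact_mod_cast (hmem x).2
    have b3 : (1 : ℝ) ≤ e x' := by exact_mod_cast (hmem x').1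
    have b4 : (e x' : ℝ) ≤ n + 1 := by exact_mod_cast (hmem x').2
    rw [hdX, abs_le]
    constructor <;> linarith
  refine le_antisymm ?_ (le_eMGHDist fun D f g hD hf hg => ?_)
  · obtain ⟨x₁, hx₁⟩ := hex 1 le_rfl (by omega)
    obtain ⟨x₂, hx₂⟩ := hex (n + 1) (by omega) le_rfl
    have hd : dist x₁ x₂ = n := by
      rw [hdX, hx₁, hx₂, abs_sub_comm]
      push_cast
      rw [add_sub_cancel_right, abs_of_nonneg hn']
    -- A constant `f` distorts by at most the diameter `n` of the path; `g` onto its two ends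
    -- distorts by `2 * n - n`.
    refine eMGHDist_le (f := fun _ => s₀) (g := fun s => if p s = 0 then x₁ else x₂) hn' ?_ ?_
    · intro x x'
      rw [dist_self, sub_zero, abs_of_nonneg dist_nonneg]
      exact hle x x'
    · intro s s'
      rw [hdS]
      by_cases h : p s = 0 <;> by_cases h' : p s' = 0
      · simp [h, h']
      · have h2 := (hpair s').resolve_left h'
        simp only [if_pos h, if_neg h', hd]
        rw [h, h2]
        push_cast
        rw [zero_sub, abs_neg, abs_of_nonneg (by positivity : (0 : ℝ) ≤ 2 * n),
          abs_of_nonneg (by linarith)]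
        linarith
      · have h2 := (hpair s).resolve_left h
        simp only [if_neg h, if_pos h', dist_comm x₂ x₁, hd]
        rw [h', h2]
        push_cast
        rw [sub_zero, abs_of_nonneg (by positivity : (0 : ℝ) ≤ 2 * n),
          abs_of_nonneg (by linarith)]
        linarith
      · have h2 := (hpair s).resolve_left h
        have h2' := (hpair s').resolve_left h'
        simp [h2, h2', hn']
  · refine ENNReal.ofReal_le_ofReal ?_
    -- Any `g` shrinks the distance `2 * n` to at most `n`.
    have h1 := (abs_le.1 (hg s₁ s₀)).2
    have h2 := hle (g s₁) (g s₀)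
    rw [hdS, hs₀, hs₁] at h1
    push_cast at h1
    rw [sub_zero, abs_of_nonneg (by positivity)] at h1
    linarith

end Path

/-! ### Assembly of the theorem. -/

theorem mainTheorem3 :
    -- the bound
    (∀ (X : Type u) (S : Type v) [MetricSpace X] [CompactSpace X] [MetricSpace S],
      IsRegularSimplex S → eGHDist X S ≤ 2 * eMGHDist X S) ∧
    -- the constant `2` cannot be lowered, not even for finite spaces
    (∀ C : ℝ≥0∞, C < 2 →
      ∃ (X : Type u) (S : Type v) (_ : MetricSpace X) (_ : MetricSpace S),
        Finite X ∧ Nonempty X ∧ Finite S ∧ Nonempty S ∧ IsRegularSimplex S ∧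
          C * eMGHDist X S < eGHDist X S) ∧
    -- the path `{1, …, n + 1}` with `d(k, j) = |k - j|` against two points at distance `2n`
    (∀ n : ℕ, 1 ≤ n →
      IsRegularSimplex ↥({0, 2 * n} : Set ℕ) ∧
      eGHDist ↥(Set.Icc 1 (n + 1) : Set ℕ) ↥({0, 2 * n} : Set ℕ) /
          eMGHDist ↥(Set.Icc 1 (n + 1) : Set ℕ) ↥({0, 2 * n} : Set ℕ) =
        ENNReal.ofReal (2 - 1 / (n : ℝ))) ∧
    -- the cases of equality
    (∀ (X : Type u) (S : Type v) [MetricSpace X] [CompactSpace X] [MetricSpace S],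
      IsRegularSimplex S →
      (Cardinal.lift.{v} #X < Cardinal.lift.{u} #S ∨
        (Cardinal.lift.{v} #X = Cardinal.lift.{u} #S ∧ #S < ℵ₀) ∨
        Metric.diam (Set.univ : Set S) ≤ 1 / 2 * Metric.diam (Set.univ : Set X)) →
      eGHDist X S = eMGHDist X S) := by
  refine ⟨fun X S _ _ _ hS => hS.eGHDist_le_two_mul, fun C hC => ?_, fun n hn => ?_,
    fun X S _ _ _ hS h => hS.eGHDist_eq_eMGHDist h⟩
  · obtain ⟨n, hn, hCn⟩ : ∃ n : ℕ, 1 ≤ n ∧ C.toReal < 2 - 1 / (n : ℝ) := by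
      have hC2 : 0 < 2 - C.toReal := by
        have := (ENNReal.toReal_lt_toReal hC.ne_top (by simp)).2 hC
        simpa using this
      obtain ⟨n, hn⟩ := exists_nat_one_div_lt hC2
      refine ⟨n + 1, by omega, ?_⟩
      push_cast
      linarith
    -- `ULift` carries the example into arbitrary universes.
    have he : Isometry fun x : ULift.{u} ↥(Set.Icc 1 (n + 1) : Set ℕ) => (x.down : ℕ) :=
      fun _ _ => rfl
    have hp : Isometry fun s : ULift.{v} ↥({0, 2 * n} : Set ℕ) => (s.down : ℕ) :=
      fun _ _ => rfl
    have her : Set.range (fun x : ULift.{u} ↥(Set.Icc 1 (n + 1) : Set ℕ) => (x.down : ℕ)) =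
        Set.Icc 1 (n + 1) := by
      ext k; exact ⟨fun ⟨x, hx⟩ => hx ▸ x.down.2, fun hk => ⟨⟨k, hk⟩, rfl⟩⟩
    have hpr : Set.range (fun s : ULift.{v} ↥({0, 2 * n} : Set ℕ) => (s.down : ℕ)) =
        {0, 2 * n} := by
      ext k; exact ⟨fun ⟨x, hx⟩ => hx ▸ x.down.2, fun hk => ⟨⟨k, hk⟩, rfl⟩⟩
    have hn' : (1 : ℝ) ≤ n := by exact_mod_cast hn
    refine ⟨ULift ↥(Set.Icc 1 (n + 1) : Set ℕ), ULift ↥({0, 2 * n} : Set ℕ), inferInstance,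
      inferInstance, inferInstance, ⟨⟨1, by simp⟩⟩, inferInstance, ⟨⟨0, by simp⟩⟩,
      isRegularSimplex_of_range_eq_pair hp hpr, ?_⟩
    rw [eGHDist_path hn he her hp hpr, eMGHDist_path he her hp hpr,
      ← ENNReal.ofReal_toReal hC.ne_top, ← ENNReal.ofReal_mul ENNReal.toReal_nonneg,
      ENNReal.ofReal_lt_ofReal_iff (by linarith)]
    calc C.toReal * (n / 2) < (2 - 1 / (n : ℝ)) * (n / 2) :=
          mul_lt_mul_of_pos_right hCn (by linarith)
      _ = (2 * n - 1) / 2 := by field_simp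
  · have hn' : (1 : ℝ) ≤ n := by exact_mod_cast hn
    have her := Subtype.range_val (s := (Set.Icc 1 (n + 1) : Set ℕ))
    have hpr := Subtype.range_val (s := ({0, 2 * n} : Set ℕ))
    refine ⟨isRegularSimplex_of_range_eq_pair isometry_subtype_coe hpr, ?_⟩
    rw [eGHDist_path hn isometry_subtype_coe her isometry_subtype_coe hpr,
      eMGHDist_path isometry_subtype_coe her isometry_subtype_coe hpr,
      ← ENNReal.ofReal_div_of_pos (by linarith)]
    congr 1
    field_simp
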